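/- Let $(\Theta,d)$ be a metric space whose topology is Polish, equipped with its Borel $\sigma$-algebra, and let $p\in[1,\infty)$. For probability measures $\mu,\nu$ on $\Theta$ let $$W_p(\mu,\nu)=\inf_{\pi\in\Pi(\mu,\nu)}\Big(\int_{\Theta\times\Theta} d(x,y)^p\,\mathrm{d}\pi(x,y)\Big)^{1/p}\in[0,\infty],$$ where $\Pi(\mu,\nu)$ is the set of couplings of $\mu$ and $\nu$, and let $\mathcal{P}_p(\Theta)$ be the set of Borel probability measures $\mu$ on $\Theta$ such that $\int d(x_0,x)^p\,\mu(\mathrm{d}x)<\infty$ for some (equivalently, every) $x_0\in\Theta$. For a bounded continuous function $\Phi:\Theta\to\mathbb{R}_{\ge 0}$ and a probability measure $\mu$ on $\Theta$ let $$Z_{\Phi,\mu}=\int \exp(-\Phi)\,\mathrm{d}\mu,\qquad \mu_\Phi(\mathrm{d}\theta)=\exp\big(-\Phi(\theta)-\log Z_{\Phi,\mu}\big)\,\mu(\mathrm{d}\theta).$$ Let $\mu_n,\mu\in\mathcal{P}_p(\Theta)$ for every $n\in\mathbb{N}$, and let $\Phi:\Theta\to\mathbb{R}_{\ge 0}$ be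 bounded and continuous. If $W_p\big((\mu_n)_\Phi,\mu_\Phi\big)\to 0$ as $n\to\infty$, then $Z_{\Phi,\mu_n}\to Z_{\Phi,\mu}$ and $W_p(\mu_n,\mu)\to 0$. -/

import Mathlib

open MeasureTheory Filter Topology
open scoped ENNReal BoundedContinuousFunction

namespace BayesWasserstein

noncomputable section

/-- The evidence `Z_{Φ,μ} = ∫ exp(-Φ) dμ` of a misfit `Φ` and a prior `μ`. -/
def evidence {Θ : Type*} [MeasurableSpace Θ] (Φ : Θ → ℝ) (μ : Measure Θ) : ℝ :=
  ∫ θ, Real.exp (-Φ θ) ∂μ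

/-- The normalised likelihood `ℓ_{Φ,μ} = exp(-Φ - log Z_{Φ,μ})`. -/
def likelihood {Θ : Type*} [MeasurableSpace Θ] (Φ : Θ → ℝ) (μ : Measure Θ) (θ : Θ) : ℝ :=
  Real.exp (-Φ θ - Real.log (evidence Φ μ))

/-- The posterior `μ_Φ(dθ) = ℓ_{Φ,μ}(θ) μ(dθ)`. -/
def posterior {Θ : Type*} [MeasurableSpace Θ] (Φ : Θ → ℝ) (μ : Measure Θ) : Measure Θ :=
  μ.withDensity fun θ => ENNReal.ofReal (likelihood Φ μ θ)

/-- The set `Π(μ, ν)` of couplings: probability measures on `Θ × Θ` with first marginal `μ` and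
second marginal `ν`. -/
def couplings {Θ : Type*} [MeasurableSpace Θ] (μ ν : Measure Θ) : Set (Measure (Θ × Θ)) :=
  {π | IsProbabilityMeasure π ∧ π.map Prod.fst = μ ∧ π.map Prod.snd = ν}

/-- The `p`-Wasserstein distance
`W_p(μ, ν) = inf_{π ∈ Π(μ, ν)} (∫ d(x, y) ^ p dπ(x, y)) ^ (1 / p)`, with values in `[0, ∞]`. -/
def wasserstein {Θ : Type*} [MetricSpace Θ] [MeasurableSpace Θ] (p : ℝ) (μ ν : Measure Θ) :
    ℝ≥0∞ :=
  ⨅ π ∈ couplings μ ν, (∫⁻ z, edist z.1 z.2 ^ p ∂π) ^ (1 / p)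

/-- The `p`-Wasserstein space `P_p(Θ)`: probability measures with finite `p`-th moment
`∫ d(x₀, x) ^ p dμ(x)` about some point `x₀`. For `1 ≤ p` the choice of `x₀` does not matter, see
`mem_wassersteinSpace_iff`. -/
def wassersteinSpace (Θ : Type*) [MetricSpace Θ] [MeasurableSpace Θ] (p : ℝ) :
    Set (Measure Θ) :=
  {μ | IsProbabilityMeasure μ ∧ ∃ x₀ : Θ, ∫⁻ x, edist x₀ x ^ p ∂μ < ∞}

theorem mem_wassersteinSpace_iff {Θ : Type*} [MetricSpace Θ] [MeasurableSpace Θ]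
    {p : ℝ} (hp : 1 ≤ p) (μ : Measure Θ) (x₀ : Θ) :
    μ ∈ wassersteinSpace Θ p ↔ IsProbabilityMeasure μ ∧ ∫⁻ x, edist x₀ x ^ p ∂μ < ∞ := by
  refine ⟨fun ⟨h, x₁, h₁⟩ => ⟨h, ?_⟩, fun ⟨h, h₀⟩ => ⟨h, x₀, h₀⟩⟩
  have hp0 : 0 ≤ p := zero_le_one.trans hp
  have hc : (2 : ℝ≥0∞) ^ (p - 1) ≠ ∞ :=
    ENNReal.rpow_ne_top_of_nonneg (by linarith) (by norm_num)
  calc ∫⁻ x, edist x₀ x ^ p ∂μ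
      ≤ ∫⁻ x, 2 ^ (p - 1) * (edist x₀ x₁ ^ p + edist x₁ x ^ p) ∂μ := by
        refine lintegral_mono fun x => ?_
        exact (ENNReal.rpow_le_rpow (edist_triangle x₀ x₁ x) hp0).trans
          (ENNReal.rpow_add_le_mul_rpow_add_rpow _ _ hp)
    _ = 2 ^ (p - 1) * (edist x₀ x₁ ^ p + ∫⁻ x, edist x₁ x ^ p ∂μ) := by
        rw [lintegral_const_mul' _ _ hc, lintegral_add_left measurable_const, lintegral_const,
          measure_univ, mul_one]
    _ < ∞ := by
        refine ENNReal.mul_lt_top hc.lt_top (ENNReal.add_lt_top.2 ⟨?_, h₁⟩)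
        exact (ENNReal.rpow_ne_top_of_nonneg hp0 (edist_ne_top _ _)).lt_top

end

end BayesWasserstein

/-!
The prior is recovered from the posterior by reweighting: `μ` has density `Z exp(Φ)` with respect to
`μ_Φ`, where `Z = 1 / ∫ exp(Φ) dμ_Φ` (`posterior_withDensity`,
`evidence_eq_inv_integral_exp_posterior`). So it suffices that reweighting by normalised multiples of
a bounded continuous function `g`, here `g = exp(Φ)`, is continuous for `W_p`.

Let `π n` be couplings of the posteriors `ν n` and `ν` with costs tending to zero. As the second
marginal is fixed and `g` is continuous, `g(x) - g(y)` tends to zero in `π n`-measure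
(`tendsto_measure_lt_edist_comp`). The measures `F(y) π n(dx dy)` with `F ∈ L¹(ν)` are uniformly
absolutely continuous with respect to `π n` (`tendsto_setLIntegral_snd_zero`), so that
`∫ F(y) |g(x) - g(y)| dπ n → 0` (`tendsto_lintegral_mul_edist_comp`). The choice `F = 1` gives the
convergence of the evidences.

For the priors, let `a` and `b` be the two densities. A coupling of `a ν n` and `b ν` is obtained from
`min(a(x), b(y)) π n(dx dy)` by adding any coupling of the remaining mass
(`exists_coupling_withDensity`). The first part costs at most a constant times the cost of `π n`. The
cost of the second is bounded by the `p`-th moments of the remainders, hence, by the triangle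
inequality, by the cost of `π n` and `∫ F(y) |a(x) - b(y)| dπ n` with `F(y) = d(x₀, y) ^ p`. All of
these tend to zero (`tendsto_wasserstein_withDensity`). No tightness or weak compactness is needed.
-/

namespace BayesWasserstein

/-! ### Uniform integrability and continuity along couplings -/

theorem tendsto_measure_edist_ge {Θ ι : Type*} [MetricSpace Θ] [PolishSpace Θ] [MeasurableSpace Θ]
    [BorelSpace Θ] {l : Filter ι} {p : ℝ} (hp : 0 < p) {π : ι → Measure (Θ × Θ)}
    (hπ : Tendsto (fun i => ∫⁻ z, edist z.1 z.2 ^ p ∂π i) l (𝓝 0))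
    {δ : ℝ≥0∞} (hδ : δ ≠ 0) (hδ' : δ ≠ ∞) :
    Tendsto (fun i => π i {z | δ ≤ edist z.1 z.2}) l (𝓝 0) := by
  have hc : δ ^ p ≠ 0 := by simp [ENNReal.rpow_eq_zero_iff, hδ, hδ']
  have hc' : δ ^ p ≠ ∞ := ENNReal.rpow_ne_top_of_nonneg hp.le hδ'
  have h0 : Tendsto (fun i => (∫⁻ z, edist z.1 z.2 ^ p ∂π i) / δ ^ p) l (𝓝 0) := by
    simpa using ENNReal.Tendsto.div_const hπ (Or.inr hc)
  refine tendsto_of_tendsto_of_tendsto_of_le_of_le tendsto_const_nhds h0 (fun _ => zero_le) ?_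
  intro i
  refine le_trans (measure_mono fun z hz => ?_)
    (meas_ge_le_lintegral_div (by fun_prop) hc hc')
  exact ENNReal.rpow_le_rpow hz hp.le

/-- If the measures `π i` share the second marginal `ν`, then for `F ∈ L¹(ν)` the measures
`F(y) π i(dx dy)` are absolutely continuous with respect to `π i` uniformly in `i`. -/
theorem tendsto_setLIntegral_snd_zero {X Θ ι : Type*} [MeasurableSpace X] [MeasurableSpace Θ]
    {l : Filter ι} {ν : Measure Θ} {π : ι → Measure (X × Θ)} (hsnd : ∀ i, (π i).map Prod.snd = ν)
    {F : Θ → ℝ≥0∞} (hF : Measurable F) (hFν : ∫⁻ y, F y ∂ν ≠ ∞)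
    {S : ι → Set (X × Θ)} (hS : Tendsto (fun i => π i (S i)) l (𝓝 0)) :
    Tendsto (fun i => ∫⁻ z in S i, F z.2 ∂π i) l (𝓝 0) := by
  rw [ENNReal.tendsto_nhds_zero]
  intro ε hε
  have hε2 : 0 < ε / 2 := ENNReal.half_pos hε.ne'
  obtain ⟨K, hK⟩ : ∃ K : ℕ, ∫⁻ y in {y | (K : ℝ≥0∞) ≤ F y}, F y ∂ν < ε / 2 := by
    have h0 : Tendsto (fun K : ℕ => ν {y | (K : ℝ≥0∞) ≤ F y}) atTop (𝓝 0) := by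
      have h1 : Tendsto (fun K : ℕ => (∫⁻ y, F y ∂ν) / (K : ℝ≥0∞)) atTop (𝓝 0) := by
        simpa using ENNReal.Tendsto.const_div ENNReal.tendsto_nat_nhds_top (Or.inr hFν)
      refine tendsto_of_tendsto_of_tendsto_of_le_of_le' tendsto_const_nhds h1
        (Eventually.of_forall fun _ => zero_le) ?_
      filter_upwards [eventually_gt_atTop 0] with K hK
      exact meas_ge_le_lintegral_div hF.aemeasurable (by exact_mod_cast hK.ne')
        (ENNReal.natCast_ne_top K)
    exact ((tendsto_setLIntegral_zero hFν h0).eventually_lt_const hε2).exists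
  have hKS : Tendsto (fun i => (K : ℝ≥0∞) * π i (S i)) l (𝓝 0) := by
    simpa using ENNReal.Tendsto.const_mul hS (Or.inr (ENNReal.natCast_ne_top K))
  filter_upwards [ENNReal.tendsto_nhds_zero.1 hKS _ hε2] with i hi
  have hm : MeasurableSet {y | (K : ℝ≥0∞) ≤ F y} := measurableSet_le measurable_const hF
  have hsplit : ∀ z : X × Θ,
      F z.2 ≤ ({y | (K : ℝ≥0∞) ≤ F y}.indicator F z.2) + K := by
    intro z
    by_cases hz : (K : ℝ≥0∞) ≤ F z.2
    · rw [Set.indicator_of_mem (by exact hz)]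
      exact le_self_add
    · exact (not_le.1 hz).le.trans le_add_self
  calc ∫⁻ z in S i, F z.2 ∂π i
      ≤ ∫⁻ z in S i, ({y | (K : ℝ≥0∞) ≤ F y}.indicator F z.2) + K ∂π i :=
        lintegral_mono hsplit
    _ = (∫⁻ z in S i, {y | (K : ℝ≥0∞) ≤ F y}.indicator F z.2 ∂π i) + K * π i (S i) := by
        rw [lintegral_add_right _ measurable_const, setLIntegral_const]
    _ ≤ (∫⁻ z, {y | (K : ℝ≥0∞) ≤ F y}.indicator F z.2 ∂π i) + K * π i (S i) := by
        gcongr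
        exact Measure.restrict_le_self
    _ = (∫⁻ y in {y | (K : ℝ≥0∞) ≤ F y}, F y ∂ν) + K * π i (S i) := by
        rw [← lintegral_indicator hm, ← hsnd i, lintegral_map (hF.indicator hm) measurable_snd]
    _ ≤ ε / 2 + ε / 2 := add_le_add hK.le hi
    _ = ε := ENNReal.add_halves ε

/-- If the transport costs of couplings with fixed second marginal tend to zero, then the two values
of a continuous function at the coupled points merge in measure. -/
theorem tendsto_measure_lt_edist_comp {Θ ι : Type*} [MetricSpace Θ] [PolishSpace Θ]
    [MeasurableSpace Θ] [BorelSpace Θ] {l : Filter ι} {p : ℝ} (hp : 0 < p) {ν : Measure Θ}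
    [IsFiniteMeasure ν] {π : ι → Measure (Θ × Θ)} (hsnd : ∀ i, (π i).map Prod.snd = ν)
    (hπ : Tendsto (fun i => ∫⁻ z, edist z.1 z.2 ^ p ∂π i) l (𝓝 0))
    {g : Θ → ℝ} (hg : Continuous g) {e : ℝ≥0∞} (he : 0 < e) :
    Tendsto (fun i => π i {z | e < edist (g z.1) (g z.2)}) l (𝓝 0) := by
  -- The points near which, at scale `1 / (k + 1)`, `g` oscillates by more than `e`: these open sets
  -- decrease to the empty set.
  let B : ℕ → Set Θ := fun k =>
    ⋃ x : Θ, {y | edist x y < ((k : ℝ≥0∞) + 1)⁻¹ ∧ e < edist (g x) (g y)}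
  have hB : ∀ k, IsOpen (B k) := fun k => isOpen_iUnion fun x =>
    (isOpen_lt (f := fun y => edist x y) (by fun_prop) continuous_const).inter
      (isOpen_lt (g := fun y => edist (g x) (g y)) continuous_const (by fun_prop))
  have hanti : Antitone B := by
    intro j k hjk y hy
    simp only [B, Set.mem_iUnion, Set.mem_ofPred_eq] at hy ⊢
    obtain ⟨x, hx, hx'⟩ := hy
    refine ⟨x, hx.trans_le ?_, hx'⟩
    gcongr
  have hempty : ⋂ k, B k = ∅ := by
    rw [Set.eq_empty_iff_forall_notMem]
    intro y hy
    obtain ⟨δ, hδ, hgδ⟩ := EMetric.continuousAt_iff.1 (hg.continuousAt (x := y)) e he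
    have hlim : Tendsto (fun k : ℕ => ((k : ℝ≥0∞) + 1)⁻¹) atTop (𝓝 0) := by
      have := (tendsto_add_atTop_iff_nat 1).2 ENNReal.tendsto_inv_nat_nhds_zero
      simpa using this
    obtain ⟨k, hk⟩ := (hlim.eventually_lt_const hδ).exists
    have := Set.mem_iInter.1 hy k
    simp only [B, Set.mem_iUnion, Set.mem_ofPred_eq] at this
    obtain ⟨x, hx, hx'⟩ := this
    exact absurd (hgδ (hx.trans hk)) (not_lt.2 hx'.le)
  have hνB : Tendsto (fun k => ν (B k)) atTop (𝓝 0) := by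
    have := tendsto_measure_iInter_atTop (μ := ν)
      (fun k => (hB k).measurableSet.nullMeasurableSet) hanti ⟨0, measure_ne_top _ _⟩
    simpa [hempty, Function.comp_def] using this
  rw [ENNReal.tendsto_nhds_zero]
  intro ε hε
  have hε2 : 0 < ε / 2 := ENNReal.half_pos hε.ne'
  obtain ⟨k, hk⟩ := (hνB.eventually_lt_const hε2).exists
  have hfar := tendsto_measure_edist_ge hp hπ (δ := ((k : ℝ≥0∞) + 1)⁻¹)
    (ENNReal.inv_ne_zero.2 (by finiteness)) (ENNReal.inv_ne_top.2 (by simp))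
  filter_upwards [ENNReal.tendsto_nhds_zero.1 hfar _ hε2] with i hi
  calc π i {z | e < edist (g z.1) (g z.2)}
      ≤ π i (Prod.snd ⁻¹' B k ∪ {z | ((k : ℝ≥0∞) + 1)⁻¹ ≤ edist z.1 z.2}) := by
        refine measure_mono fun z hz => ?_
        rcases lt_or_ge (edist z.1 z.2) ((k : ℝ≥0∞) + 1)⁻¹ with h | h
        · exact Or.inl (Set.mem_iUnion.2 ⟨z.1, h, hz⟩)
        · exact Or.inr h
    _ ≤ π i (Prod.snd ⁻¹' B k) + π i {z | ((k : ℝ≥0∞) + 1)⁻¹ ≤ edist z.1 z.2} :=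
        measure_union_le _ _
    _ ≤ ε / 2 + ε / 2 := by
        rw [← Measure.map_apply measurable_snd (hB k).measurableSet, hsnd i]
        exact add_le_add hk.le hi
    _ = ε := ENNReal.add_halves ε

/-- Vanishing transport cost forces `∫ F(y) |g(x) - g(y)| dπ i → 0` for every bounded continuous
`g` and every `F ∈ L¹(ν)`, where `ν` is the common second marginal. -/
theorem tendsto_lintegral_mul_edist_comp {Θ ι : Type*} [MetricSpace Θ] [PolishSpace Θ]
    [MeasurableSpace Θ] [BorelSpace Θ] {l : Filter ι} {p : ℝ} (hp : 0 < p) {ν : Measure Θ}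
    [IsFiniteMeasure ν] {π : ι → Measure (Θ × Θ)} (hsnd : ∀ i, (π i).map Prod.snd = ν)
    (hπ : Tendsto (fun i => ∫⁻ z, edist z.1 z.2 ^ p ∂π i) l (𝓝 0))
    {g : Θ → ℝ} (hg : Continuous g) {M : ℝ≥0∞} (hM : M ≠ ∞) (hgM : ∀ x y, edist (g x) (g y) ≤ M)
    {F : Θ → ℝ≥0∞} (hF : Measurable F) (hFν : ∫⁻ y, F y ∂ν ≠ ∞) :
    Tendsto (fun i => ∫⁻ z, F z.2 * edist (g z.1) (g z.2) ∂π i) l (𝓝 0) := by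
  rw [ENNReal.tendsto_nhds_zero]
  intro ε hε
  have hε2 : 0 < ε / 2 := ENNReal.half_pos hε.ne'
  obtain ⟨e, he, heI⟩ : ∃ e : ℝ≥0∞, 0 < e ∧ e * ∫⁻ y, F y ∂ν < ε / 2 := by
    obtain ⟨e, he, h⟩ := ENNReal.exists_nnreal_pos_mul_lt hFν hε2.ne'
    exact ⟨e, by exact_mod_cast he, h⟩
  let S : Set (Θ × Θ) := {z | e < edist (g z.1) (g z.2)}
  have hSm : MeasurableSet S :=
    (isOpen_lt continuous_const (by fun_prop)).measurableSet
  have hint := tendsto_setLIntegral_snd_zero hsnd hF hFν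
    (tendsto_measure_lt_edist_comp hp hsnd hπ hg he)
  have hMint : Tendsto (fun i => M * ∫⁻ z in S, F z.2 ∂π i) l (𝓝 0) := by
    simpa using ENNReal.Tendsto.const_mul hint (Or.inr hM)
  filter_upwards [ENNReal.tendsto_nhds_zero.1 hMint _ hε2] with i hi
  have hF2 : Measurable fun z : Θ × Θ => F z.2 := hF.comp measurable_snd
  calc ∫⁻ z, F z.2 * edist (g z.1) (g z.2) ∂π i
      ≤ ∫⁻ z, e * F z.2 + M * S.indicator (fun z => F z.2) z ∂π i := by
        refine lintegral_mono fun z => ?_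
        by_cases hz : z ∈ S
        · rw [Set.indicator_of_mem hz, mul_comm]
          exact le_add_left (mul_le_mul_left (hgM _ _) _)
        · rw [mul_comm]
          exact le_add_right (mul_le_mul_left (not_lt.1 hz) _)
    _ = e * ∫⁻ y, F y ∂ν + M * ∫⁻ z in S, F z.2 ∂π i := by
        rw [lintegral_add_left (hF2.const_mul e), lintegral_const_mul _ hF2,
          lintegral_const_mul _ (hF2.indicator hSm), lintegral_indicator hSm, ← hsnd i,
          lintegral_map hF measurable_snd]
    _ ≤ ε / 2 + ε / 2 := add_le_add heI.le hi
    _ = ε := ENNReal.add_halves ε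

/-! ### Couplings of reweighted measures -/

/-- Measures of equal finite mass are the marginals of their normalised product. If the mass is
zero then both measures vanish and so does the product, whatever `0⁻¹ = ∞` contributes. -/
theorem exists_map_fst_eq_map_snd_eq {X Y : Type*} [MeasurableSpace X] [MeasurableSpace Y]
    (α : Measure X) (β : Measure Y) [IsFiniteMeasure α] [IsFiniteMeasure β]
    (h : α Set.univ = β Set.univ) :
    ∃ γ : Measure (X × Y), γ.map Prod.fst = α ∧ γ.map Prod.snd = β := by
  refine ⟨(α Set.univ)⁻¹ • α.prod β, ?_, ?_⟩
  · rw [Measure.map_smul, Measure.map_fst_prod, smul_smul, ← h]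
    by_cases h0 : α Set.univ = 0
    · simp [Measure.measure_univ_eq_zero.1 h0]
    · rw [ENNReal.inv_mul_cancel h0 (measure_ne_top _ _), one_smul]
  · rw [Measure.map_smul, Measure.map_snd_prod, smul_smul]
    by_cases h0 : α Set.univ = 0
    · simp [Measure.measure_univ_eq_zero.1 (h ▸ h0 : β Set.univ = 0)]
    · rw [ENNReal.inv_mul_cancel h0 (measure_ne_top _ _), one_smul]

theorem map_withDensity_comp {X Y : Type*} [MeasurableSpace X] [MeasurableSpace Y] (π : Measure X)
    {f : X → Y} (hf : Measurable f) {a : Y → ℝ≥0∞} (ha : Measurable a) :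
    (π.withDensity fun z => a (f z)).map f = (π.map f).withDensity a := by
  ext s hs
  rw [Measure.map_apply hf hs, withDensity_apply _ (hf hs), withDensity_apply _ hs,
    setLIntegral_map hs ha hf]

/-- A coupling `π` of `ν₁` and `ν₂` yields a coupling of the probability measures `a ν₁` and `b ν₂`:
keep the mass `min(a(x), b(y)) π(dx dy)` and couple the two remainders arbitrarily. -/
theorem exists_coupling_withDensity {Θ : Type*} [MetricSpace Θ] [PolishSpace Θ] [MeasurableSpace Θ]
    [BorelSpace Θ] {p : ℝ} (hp : 1 ≤ p) (x₀ : Θ) {ν₁ ν₂ : Measure Θ} {π : Measure (Θ × Θ)}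
    (hπ : π ∈ couplings ν₁ ν₂) {a b : Θ → ℝ≥0∞} (ha : Measurable a) (hb : Measurable b)
    (ha1 : ∫⁻ x, a x ∂ν₁ = 1) (hb1 : ∫⁻ y, b y ∂ν₂ = 1) :
    ∃ π' ∈ couplings (ν₁.withDensity a) (ν₂.withDensity b),
      ∫⁻ z, edist z.1 z.2 ^ p ∂π' ≤ (∫⁻ z, min (a z.1) (b z.2) * edist z.1 z.2 ^ p ∂π)
        + 2 ^ (p - 1) * ((∫⁻ z, (a z.1 - b z.2) * edist x₀ z.1 ^ p ∂π)
          + ∫⁻ z, (b z.2 - a z.1) * edist x₀ z.2 ^ p ∂π) := by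
  obtain ⟨hprob, hfst, hsnd⟩ := hπ
  have hp0 : 0 ≤ p := zero_le_one.trans hp
  have ha' : Measurable fun z : Θ × Θ => a z.1 := ha.comp measurable_fst
  have hb' : Measurable fun z : Θ × Θ => b z.2 := hb.comp measurable_snd
  -- Subtraction in `ℝ≥0∞` truncates, so `r` and `s` are the excesses of each density over the other.
  let m : Θ × Θ → ℝ≥0∞ := fun z => min (a z.1) (b z.2)
  have hm : Measurable m := ha'.min hb'
  let r : Θ × Θ → ℝ≥0∞ := fun z => a z.1 - b z.2
  have hr : Measurable r := ha'.sub hb'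
  let s : Θ × Θ → ℝ≥0∞ := fun z => b z.2 - a z.1
  have hs : Measurable s := hb'.sub ha'
  have hma : m + r = fun z => a z.1 := by
    funext z
    simp only [Pi.add_apply, m, r]
    rw [add_comm, tsub_add_min]
  have hmb : m + s = fun z => b z.2 := by
    funext z
    simp only [Pi.add_apply, m, s]
    rw [add_comm, min_comm, tsub_add_min]
  have hIa : ∫⁻ z, m z ∂π + ∫⁻ z, r z ∂π = 1 := by
    rw [← lintegral_add_left hm, ← ha1, ← hfst, lintegral_map ha measurable_fst]
    exact congrArg (fun f => ∫⁻ z, f z ∂π) hma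
  have hIb : ∫⁻ z, m z ∂π + ∫⁻ z, s z ∂π = 1 := by
    rw [← lintegral_add_left hm, ← hb1, ← hsnd, lintegral_map hb measurable_snd]
    exact congrArg (fun f => ∫⁻ z, f z ∂π) hmb
  have hm_ne : ∫⁻ z, m z ∂π ≠ ∞ := ne_top_of_le_ne_top ENNReal.one_ne_top (hIa ▸ le_self_add)
  have hr_ne : ∫⁻ z, r z ∂π ≠ ∞ := ne_top_of_le_ne_top ENNReal.one_ne_top (hIa ▸ le_add_self)
  have hs_ne : ∫⁻ z, s z ∂π ≠ ∞ := ne_top_of_le_ne_top ENNReal.one_ne_top (hIb ▸ le_add_self)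
  have : IsFiniteMeasure (π.withDensity r) := isFiniteMeasure_withDensity hr_ne
  have : IsFiniteMeasure (π.withDensity s) := isFiniteMeasure_withDensity hs_ne
  obtain ⟨γ, hγ1, hγ2⟩ := exists_map_fst_eq_map_snd_eq
    ((π.withDensity r).map Prod.fst) ((π.withDensity s).map Prod.snd) (by
      rw [Measure.map_apply measurable_fst .univ, Measure.map_apply measurable_snd .univ,
        Set.preimage_univ, Set.preimage_univ, withDensity_apply _ .univ, withDensity_apply _ .univ,
        Measure.restrict_univ]
      exact (ENNReal.add_right_inj hm_ne).1 (hIa.trans hIb.symm))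
  have h1 : (π.withDensity m + γ).map Prod.fst = ν₁.withDensity a := by
    rw [Measure.map_add _ _ measurable_fst, hγ1, ← Measure.map_add _ _ measurable_fst,
      ← withDensity_add_left hm, hma, map_withDensity_comp π measurable_fst ha, hfst]
  have h2 : (π.withDensity m + γ).map Prod.snd = ν₂.withDensity b := by
    rw [Measure.map_add _ _ measurable_snd, hγ2, ← Measure.map_add _ _ measurable_snd,
      ← withDensity_add_left hm, hmb, map_withDensity_comp π measurable_snd hb, hsnd]
  refine ⟨π.withDensity m + γ, ⟨⟨?_⟩, h1, h2⟩, ?_⟩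
  · rw [← Set.preimage_univ (f := Prod.fst), ← Measure.map_apply measurable_fst .univ, h1,
      withDensity_apply _ .univ, Measure.restrict_univ, ha1]
  · have hd : Measurable fun z : Θ × Θ => edist z.1 z.2 ^ p := by fun_prop
    have hd0 : Measurable fun x : Θ => edist x₀ x ^ p := by fun_prop
    have hd1 : Measurable fun z : Θ × Θ => edist x₀ z.1 ^ p := by fun_prop
    have hd2 : Measurable fun z : Θ × Θ => edist x₀ z.2 ^ p := by fun_prop
    have hc : (2 : ℝ≥0∞) ^ (p - 1) ≠ ∞ :=
      ENNReal.rpow_ne_top_of_nonneg (by linarith) (by norm_num)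
    rw [lintegral_add_measure, lintegral_withDensity_eq_lintegral_mul _ hm hd]
    refine add_le_add le_rfl ?_
    calc ∫⁻ z, edist z.1 z.2 ^ p ∂γ
        ≤ ∫⁻ z, 2 ^ (p - 1) * (edist x₀ z.1 ^ p + edist x₀ z.2 ^ p) ∂γ := by
          refine lintegral_mono fun z => ?_
          exact (ENNReal.rpow_le_rpow (edist_triangle_left z.1 z.2 x₀) hp0).trans
            (ENNReal.rpow_add_le_mul_rpow_add_rpow _ _ hp)
      _ = 2 ^ (p - 1) * (∫⁻ x, edist x₀ x ^ p ∂(γ.map Prod.fst)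
            + ∫⁻ y, edist x₀ y ^ p ∂(γ.map Prod.snd)) := by
          rw [lintegral_const_mul' _ _ hc, lintegral_add_left hd1,
            lintegral_map hd0 measurable_fst, lintegral_map hd0 measurable_snd]
      _ = _ := by
          rw [hγ1, hγ2, lintegral_map hd0 measurable_fst, lintegral_map hd0 measurable_snd,
            lintegral_withDensity_eq_lintegral_mul _ hr hd1,
            lintegral_withDensity_eq_lintegral_mul _ hs hd2]
          rfl

/-! ### Continuity of reweighting in the Wasserstein distance -/

/-- Convergence in `W_p` is witnessed by couplings with vanishing cost. The slack `e` is needed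
because the infimum is not assumed to be attained; where `W_p = ∞` the product coupling serves. -/
theorem exists_couplings_tendsto_zero {Θ ι : Type*} [MetricSpace Θ] [MeasurableSpace Θ]
    {l : Filter ι} {p : ℝ} (hp : 0 < p) {νs : ι → Measure Θ} {ν : Measure Θ}
    [∀ i, IsProbabilityMeasure (νs i)] [IsProbabilityMeasure ν]
    (h : Tendsto (fun i => wasserstein p (νs i) ν) l (𝓝 0)) {e : ι → ℝ≥0∞} (he : ∀ i, e i ≠ 0)
    (hel : Tendsto e l (𝓝 0)) :
    ∃ π : ι → Measure (Θ × Θ), (∀ i, π i ∈ couplings (νs i) ν) ∧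
      Tendsto (fun i => ∫⁻ z, edist z.1 z.2 ^ p ∂π i) l (𝓝 0) := by
  have hex : ∀ i, ∃ π ∈ couplings (νs i) ν,
      (∫⁻ z, edist z.1 z.2 ^ p ∂π) ^ (1 / p) ≤ wasserstein p (νs i) ν + e i := by
    intro i
    by_cases htop : wasserstein p (νs i) ν = ∞
    · exact ⟨(νs i).prod ν, ⟨inferInstance, by simp, by simp⟩, by simp [htop]⟩
    · have hlt : wasserstein p (νs i) ν < wasserstein p (νs i) ν + e i :=
        ENNReal.lt_add_right htop (he i)
      obtain ⟨π, hπ⟩ := iInf_lt_iff.1 hlt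
      obtain ⟨hπ, hc⟩ := iInf_lt_iff.1 hπ
      exact ⟨π, hπ, hc.le⟩
  choose π hπ hc using hex
  refine ⟨π, hπ, ?_⟩
  have h0 : Tendsto (fun i => (wasserstein p (νs i) ν + e i) ^ p) l (𝓝 0) := by
    have := (ENNReal.continuous_rpow_const (y := p)).tendsto 0 |>.comp (by simpa using h.add hel)
    simpa [Function.comp_def, ENNReal.zero_rpow_of_pos hp] using this
  refine tendsto_of_tendsto_of_tendsto_of_le_of_le tendsto_const_nhds h0 (fun _ => zero_le) ?_
  intro i
  have := ENNReal.rpow_le_rpow (hc i) hp.le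
  rwa [← ENNReal.rpow_mul, one_div, inv_mul_cancel₀ hp.ne', ENNReal.rpow_one] at this

/-- Reweighting by normalised multiples `c i * g` of a bounded continuous function preserves
convergence in `W_p`. The bound `c i ≤ 1` serves only to control the densities uniformly. -/
theorem tendsto_wasserstein_withDensity {Θ ι : Type*} [MetricSpace Θ] [PolishSpace Θ]
    [MeasurableSpace Θ] [BorelSpace Θ] {l : Filter ι} {p : ℝ} (hp : 1 ≤ p) {νs : ι → Measure Θ}
    {ν : Measure Θ} [IsFiniteMeasure ν] {π : ι → Measure (Θ × Θ)}
    (hcpl : ∀ i, π i ∈ couplings (νs i) ν)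
    (hπ : Tendsto (fun i => ∫⁻ z, edist z.1 z.2 ^ p ∂π i) l (𝓝 0))
    {x₀ : Θ} (hν : ∫⁻ y, edist x₀ y ^ p ∂ν ≠ ∞)
    {g : Θ → ℝ} (hg : Continuous g) {M : ℝ} (hg0 : ∀ x, 0 ≤ g x) (hgM : ∀ x, g x ≤ M)
    {c : ι → ℝ} {c₀ : ℝ} (hc0 : ∀ i, 0 ≤ c i) (hc1 : ∀ i, c i ≤ 1) (hc : Tendsto c l (𝓝 c₀))
    (hcs : ∀ i, ∫⁻ x, ENNReal.ofReal (g x * c i) ∂νs i = 1)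
    (hcν : ∫⁻ y, ENNReal.ofReal (g y * c₀) ∂ν = 1) :
    Tendsto (fun i => wasserstein p ((νs i).withDensity fun x => ENNReal.ofReal (g x * c i))
      (ν.withDensity fun y => ENNReal.ofReal (g y * c₀))) l (𝓝 0) := by
  have hp0 : 0 < p := zero_lt_one.trans_le hp
  set k : ℝ≥0∞ := 2 ^ (p - 1) with hk
  have hktop : k ≠ ∞ := ENNReal.rpow_ne_top_of_nonneg (by linarith) (by norm_num)
  set m : ℝ≥0∞ := ENNReal.ofReal M with hm
  have hmtop : m ≠ ∞ := ENNReal.ofReal_ne_top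
  let F : Θ → ℝ≥0∞ := fun y => edist x₀ y ^ p
  have hF : Measurable F := by fun_prop
  have hF1 : Measurable fun z : Θ × Θ => F z.1 := hF.comp measurable_fst
  have hF2 : Measurable fun z : Θ × Θ => F z.2 := hF.comp measurable_snd
  have hd : Measurable fun z : Θ × Θ => edist z.1 z.2 ^ p := by fun_prop
  have hgm : Measurable g := hg.measurable
  -- `C i` is the transport cost of `π i`; `D i` bounds the error made by matching densities along
  -- `π i`, weighted with `F`, and separates the variation of `g` from that of the constants.
  let C : ι → ℝ≥0∞ := fun i => ∫⁻ z, edist z.1 z.2 ^ p ∂π i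
  let D : ι → ℝ≥0∞ := fun i =>
    (∫⁻ z, F z.2 * edist (g z.1) (g z.2) ∂π i) + m * edist (c i) c₀ * ∫⁻ y, F y ∂ν
  have hD : Tendsto D l (𝓝 0) := by
    have h1 := tendsto_lintegral_mul_edist_comp hp0 (fun i => (hcpl i).2.2) hπ hg hmtop
      (fun x y => by
        rw [edist_dist, Real.dist_eq]
        exact ENNReal.ofReal_le_ofReal
          (abs_sub_le_of_nonneg_of_le (hg0 x) (hgM x) (hg0 y) (hgM y))) hF hν
    have h2 : Tendsto (fun i => edist (c i) c₀) l (𝓝 0) := tendsto_iff_edist_tendsto_0.1 hc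
    have h3 := ENNReal.Tendsto.mul_const (ENNReal.Tendsto.const_mul h2 (Or.inr hmtop))
      (Or.inr hν)
    simpa [D] using h1.add h3
  have hbound : Tendsto (fun i => m * C i + k * (k * (m * C i + D i) + D i)) l (𝓝 0) := by
    have h1 : Tendsto (fun i => m * C i) l (𝓝 0) := by
      simpa using ENNReal.Tendsto.const_mul hπ (Or.inr hmtop)
    have h2 : Tendsto (fun i => k * (m * C i + D i)) l (𝓝 0) := by
      simpa using ENNReal.Tendsto.const_mul (h1.add hD) (Or.inr hktop)
    have h3 : Tendsto (fun i => k * (k * (m * C i + D i) + D i)) l (𝓝 0) := by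
      simpa using ENNReal.Tendsto.const_mul (h2.add hD) (Or.inr hktop)
    simpa using h1.add h3
  have hroot : Tendsto (fun i => (m * C i + k * (k * (m * C i + D i) + D i)) ^ (1 / p))
      l (𝓝 0) := by
    have := ((ENNReal.continuous_rpow_const (y := 1 / p)).tendsto 0).comp hbound
    simpa [Function.comp_def, ENNReal.zero_rpow_of_pos, hp0] using this
  refine tendsto_of_tendsto_of_tendsto_of_le_of_le tendsto_const_nhds hroot (fun _ => zero_le) ?_
  intro i
  let a : Θ → ℝ≥0∞ := fun x => ENNReal.ofReal (g x * c i)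
  let b : Θ → ℝ≥0∞ := fun y => ENNReal.ofReal (g y * c₀)
  have ha : Measurable a := by fun_prop
  have hb : Measurable b := by fun_prop
  have ham : ∀ x, a x ≤ m := fun x =>
    ENNReal.ofReal_le_ofReal ((mul_le_of_le_one_right (hg0 x) (hc1 i)).trans (hgM x))
  have hdiff : ∀ x y, edist (g x * c i) (g y * c₀) ≤ edist (g x) (g y) + m * edist (c i) c₀ := by
    intro x y
    have hM : 0 ≤ M := (hg0 x).trans (hgM x)
    rw [edist_dist, edist_dist, edist_dist, hm, ← ENNReal.ofReal_mul hM,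
      ← ENNReal.ofReal_add dist_nonneg (mul_nonneg hM dist_nonneg)]
    refine ENNReal.ofReal_le_ofReal ?_
    rw [Real.dist_eq, Real.dist_eq, Real.dist_eq]
    calc |g x * c i - g y * c₀| = |(g x - g y) * c i + g y * (c i - c₀)| := by ring_nf
      _ ≤ |g x - g y| * c i + g y * |c i - c₀| := by
          refine (abs_add_le _ _).trans_eq ?_
          rw [abs_mul, abs_mul, abs_of_nonneg (hc0 i), abs_of_nonneg (hg0 y)]
      _ ≤ |g x - g y| + M * |c i - c₀| :=
          add_le_add (mul_le_of_le_one_right (abs_nonneg _) (hc1 i))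
            (mul_le_mul_of_nonneg_right (hgM y) (abs_nonneg _))
  have htsub : ∀ s t : ℝ, 0 ≤ t → ENNReal.ofReal s - ENNReal.ofReal t ≤ edist s t := by
    intro s t ht
    rw [← ENNReal.ofReal_sub _ ht, edist_dist, Real.dist_eq]
    exact ENNReal.ofReal_le_ofReal (le_abs_self _)
  -- A negative `c₀` would make the density `ofReal (g * c₀)` vanish.
  have hc₀ : ∀ y, 0 ≤ g y * c₀ := by
    intro y
    by_contra hneg
    have hc₀neg : c₀ < 0 := by
      by_contra h
      exact hneg (mul_nonneg (hg0 y) (not_lt.1 h))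
    have : ∀ y, ENNReal.ofReal (g y * c₀) = 0 := fun y =>
      ENNReal.ofReal_eq_zero.2 (mul_nonpos_of_nonneg_of_nonpos (hg0 y) hc₀neg.le)
    simp [this] at hcν
  have hab : ∀ x y, a x - b y ≤ edist (g x) (g y) + m * edist (c i) c₀ := fun x y =>
    (htsub _ _ (hc₀ y)).trans (hdiff x y)
  have hba : ∀ x y, b y - a x ≤ edist (g x) (g y) + m * edist (c i) c₀ := fun x y =>
    (htsub _ _ (mul_nonneg (hg0 x) (hc0 i))).trans ((edist_comm _ _).trans_le (hdiff x y))
  have hDi : ∫⁻ z, (edist (g z.1) (g z.2) + m * edist (c i) c₀) * F z.2 ∂π i = D i := by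
    have hFν : ∫⁻ y, F y ∂ν = ∫⁻ z, F z.2 ∂π i := by
      rw [← (hcpl i).2.2, lintegral_map hF measurable_snd]
    simp only [D, hFν]
    rw [← lintegral_const_mul _ hF2, ← lintegral_add_right _ (hF2.const_mul _)]
    refine lintegral_congr fun z => ?_
    rw [add_mul, mul_comm (F z.2)]
  obtain ⟨π', hπ', hcost⟩ := exists_coupling_withDensity hp x₀ (hcpl i) ha hb (hcs i) hcν
  refine (iInf₂_le π' hπ').trans (ENNReal.rpow_le_rpow (hcost.trans ?_) (by positivity))
  refine add_le_add ?_ (mul_le_mul_right (add_le_add ?_ ?_) _)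
  · rw [← lintegral_const_mul _ hd]
    exact lintegral_mono fun z => mul_le_mul_left ((min_le_left _ _).trans (ham _)) _
  -- The moment of the first remainder is moved to the second coordinate, whose law does not depend
  -- on `i`.
  · calc ∫⁻ z, (a z.1 - b z.2) * edist x₀ z.1 ^ p ∂π i
        ≤ ∫⁻ z, k * (m * edist z.1 z.2 ^ p
            + (edist (g z.1) (g z.2) + m * edist (c i) c₀) * F z.2) ∂π i := by
          refine lintegral_mono fun z => ?_
          have htri : edist x₀ z.1 ^ p ≤ k * (edist z.1 z.2 ^ p + F z.2) :=
            (ENNReal.rpow_le_rpow ((edist_triangle_right x₀ z.1 z.2).trans_eq (add_comm _ _))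
              hp0.le).trans (ENNReal.rpow_add_le_mul_rpow_add_rpow _ _ hp)
          calc (a z.1 - b z.2) * edist x₀ z.1 ^ p
              ≤ (a z.1 - b z.2) * (k * (edist z.1 z.2 ^ p + F z.2)) := mul_le_mul_right htri _
            _ = k * ((a z.1 - b z.2) * edist z.1 z.2 ^ p + (a z.1 - b z.2) * F z.2) := by ring
            _ ≤ _ := mul_le_mul_right (add_le_add
                (mul_le_mul_left (tsub_le_self.trans (ham _)) _)
                (mul_le_mul_left (hab _ _) _)) _
      _ = k * (m * C i + D i) := by
          rw [lintegral_const_mul' _ _ hktop, lintegral_add_left (hd.const_mul _),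
            lintegral_const_mul _ hd, hDi]
  · rw [← hDi]
    exact lintegral_mono fun z => mul_le_mul_left (hba _ _) _

/-! ### Posteriors and evidences -/

section Posterior

variable {Θ : Type*} [MetricSpace Θ] [MeasurableSpace Θ] [BorelSpace Θ]
  (Φ : Θ →ᵇ ℝ) (μ : Measure Θ) [IsProbabilityMeasure μ]

theorem integrable_exp_neg (hΦ : ∀ θ, 0 ≤ Φ θ) : Integrable (fun θ => Real.exp (-Φ θ)) μ := by
  refine Integrable.of_bound (by fun_prop) 1 (ae_of_all _ fun θ => ?_)
  simpa [abs_of_pos (Real.exp_pos _)] using hΦ θ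

theorem evidence_pos (hΦ : ∀ θ, 0 ≤ Φ θ) : 0 < evidence Φ μ :=
  integral_exp_pos (integrable_exp_neg Φ μ hΦ)

theorem evidence_le_one (hΦ : ∀ θ, 0 ≤ Φ θ) : evidence Φ μ ≤ 1 := by
  have := integral_mono (integrable_exp_neg Φ μ hΦ) (integrable_const (1 : ℝ))
    (fun θ => by simpa using hΦ θ)
  rw [integral_const, probReal_univ, one_smul] at this
  exact this

theorem isProbabilityMeasure_posterior (hΦ : ∀ θ, 0 ≤ Φ θ) :
    IsProbabilityMeasure (posterior Φ μ) := by
  have hZ := evidence_pos Φ μ hΦ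
  have hl : ∀ θ, likelihood Φ μ θ = Real.exp (-Φ θ) / evidence Φ μ := fun θ => by
    rw [likelihood, Real.exp_sub, Real.exp_log hZ]
  refine ⟨?_⟩
  rw [posterior, withDensity_apply _ .univ, Measure.restrict_univ]
  simp only [hl]
  rw [← ofReal_integral_eq_lintegral_ofReal ((integrable_exp_neg Φ μ hΦ).div_const _)
    (ae_of_all _ fun θ => by positivity), integral_div]
  change ENNReal.ofReal (evidence Φ μ / evidence Φ μ) = 1
  rw [div_self hZ.ne', ENNReal.ofReal_one]

/-- The prior is the posterior reweighted by `exp(Φ) Z`. -/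
theorem posterior_withDensity (hΦ : ∀ θ, 0 ≤ Φ θ) :
    (posterior Φ μ).withDensity (fun θ => ENNReal.ofReal (Real.exp (Φ θ) * evidence Φ μ)) = μ := by
  have hZ := evidence_pos Φ μ hΦ
  have hm : Measurable fun θ => ENNReal.ofReal (likelihood Φ μ θ) := by
    unfold likelihood
    fun_prop
  rw [posterior, ← withDensity_mul _ hm (by fun_prop)]
  convert withDensity_one (μ := μ) using 2
  funext θ
  simp only [Pi.mul_apply, Pi.one_apply]
  rw [← ENNReal.ofReal_mul (show 0 ≤ likelihood Φ μ θ from (Real.exp_pos _).le), likelihood,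
    Real.exp_sub, Real.exp_log hZ,
    Real.exp_neg]
  have := Real.exp_pos (Φ θ)
  field_simp
  simp

theorem lintegral_exp_mul_evidence_posterior (hΦ : ∀ θ, 0 ≤ Φ θ) :
    ∫⁻ θ, ENNReal.ofReal (Real.exp (Φ θ) * evidence Φ μ) ∂posterior Φ μ = 1 := by
  have h := congrArg (fun ν => ν Set.univ) (posterior_withDensity Φ μ hΦ)
  simpa [withDensity_apply _ MeasurableSet.univ] using h

/-- The evidence is determined by the posterior, through a bounded continuous observable. -/
theorem evidence_eq_inv_integral_exp_posterior (hΦ : ∀ θ, 0 ≤ Φ θ) :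
    evidence Φ μ = (∫ θ, Real.exp (Φ θ) ∂posterior Φ μ)⁻¹ := by
  have hZ := evidence_pos Φ μ hΦ
  have h : ∫ θ, Real.exp (Φ θ) * evidence Φ μ ∂posterior Φ μ = 1 := by
    rw [integral_eq_lintegral_of_nonneg_ae (ae_of_all _ fun θ => by positivity)
      (by fun_prop), lintegral_exp_mul_evidence_posterior Φ μ hΦ, ENNReal.toReal_one]
  rw [integral_mul_const] at h
  exact eq_inv_of_mul_eq_one_right h

end Posterior

/-- The posterior density is bounded by `1 / Z`, so posteriors inherit integrability. -/
theorem lintegral_posterior_ne_top {Θ : Type*} [MetricSpace Θ] [MeasurableSpace Θ] [BorelSpace Θ]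
    (Φ : Θ →ᵇ ℝ) (μ : Measure Θ) (hΦ : ∀ θ, 0 ≤ Φ θ) {F : Θ → ℝ≥0∞} (hF : Measurable F)
    (h : ∫⁻ θ, F θ ∂μ ≠ ∞) : ∫⁻ θ, F θ ∂posterior Φ μ ≠ ∞ := by
  have hm : Measurable fun θ => ENNReal.ofReal (likelihood Φ μ θ) := by
    unfold likelihood
    fun_prop
  rw [posterior, lintegral_withDensity_eq_lintegral_mul _ hm hF]
  refine ne_top_of_le_ne_top (ENNReal.mul_ne_top
    (ENNReal.ofReal_ne_top (r := Real.exp (-Real.log (evidence Φ μ)))) h) ?_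
  rw [← lintegral_const_mul _ hF]
  refine lintegral_mono fun θ => mul_le_mul_left (ENNReal.ofReal_le_ofReal ?_) _
  exact Real.exp_le_exp.2 (by linarith [hΦ θ])

end BayesWasserstein

theorem mainTheorem12 {Θ : Type*} [MetricSpace Θ] [PolishSpace Θ] [MeasurableSpace Θ]
    [BorelSpace Θ] (p : ℝ) (hp : 1 ≤ p)
    (μs : ℕ → Measure Θ) (hμs : ∀ n, μs n ∈ BayesWasserstein.wassersteinSpace Θ p)
    (μ : Measure Θ) (hμ : μ ∈ BayesWasserstein.wassersteinSpace Θ p)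
    (Φ : Θ →ᵇ ℝ) (hΦ : ∀ θ, 0 ≤ Φ θ)
    (hW : Tendsto (fun n => BayesWasserstein.wasserstein p
      (BayesWasserstein.posterior Φ (μs n)) (BayesWasserstein.posterior Φ μ)) atTop (𝓝 0)) :
    Tendsto (fun n => BayesWasserstein.evidence Φ (μs n)) atTop
        (𝓝 (BayesWasserstein.evidence Φ μ)) ∧
      Tendsto (fun n => BayesWasserstein.wasserstein p (μs n) μ) atTop (𝓝 0) := by
  open BayesWasserstein in
  obtain ⟨hμ1, x₀, hx₀⟩ := hμ
  have hμs1 : ∀ n, IsProbabilityMeasure (μs n) := fun n => (hμs n).1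
  have hν := isProbabilityMeasure_posterior Φ μ hΦ
  have hνs := fun n => isProbabilityMeasure_posterior Φ (μs n) hΦ
  have hp0 : 0 < p := zero_lt_one.trans_le hp
  obtain ⟨π, hcpl, hπ⟩ := exists_couplings_tendsto_zero hp0 hW
    (e := fun n : ℕ => (n : ℝ≥0∞)⁻¹) (fun n => ENNReal.inv_ne_zero.2 (ENNReal.natCast_ne_top n))
    ENNReal.tendsto_inv_nat_nhds_zero
  let g : Θ → ℝ := fun θ => Real.exp (Φ θ)
  have hg : Continuous g := by fun_prop
  have hg0 : ∀ θ, 0 ≤ g θ := fun θ => (Real.exp_pos _).le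
  have hgM : ∀ θ, g θ ≤ Real.exp ‖Φ‖ := fun θ =>
    Real.exp_le_exp.2 ((le_abs_self _).trans (Φ.norm_coe_le_norm θ))
  have hgi : ∀ {X : Type _} [MeasurableSpace X] (ρ : Measure X) [IsFiniteMeasure ρ] {f : X → Θ}
      (_ : Measurable f), Integrable (fun x => g (f x)) ρ := fun ρ _ f hf =>
    Integrable.of_bound (hg.measurable.comp hf).aestronglyMeasurable (Real.exp ‖Φ‖)
      (ae_of_all _ fun x => by rw [Real.norm_of_nonneg (hg0 _)]; exact hgM _)
  have hint : Tendsto (fun n => ∫ θ, g θ ∂posterior Φ (μs n)) atTop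
      (𝓝 (∫ θ, g θ ∂posterior Φ μ)) := by
    rw [tendsto_iff_edist_tendsto_0]
    have h := tendsto_lintegral_mul_edist_comp hp0 (fun n => (hcpl n).2.2) hπ hg
      (M := ENNReal.ofReal (Real.exp ‖Φ‖)) ENNReal.ofReal_ne_top (fun x y => by
        rw [edist_dist, Real.dist_eq]
        exact ENNReal.ofReal_le_ofReal
          (abs_sub_le_of_nonneg_of_le (hg0 x) (hgM x) (hg0 y) (hgM y)))
      (F := fun _ => 1) measurable_const (by simp)
    refine tendsto_of_tendsto_of_tendsto_of_le_of_le tendsto_const_nhds h (fun _ => zero_le) ?_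
    intro n
    have := (hcpl n).1
    have h1 : ∫ θ, g θ ∂posterior Φ (μs n) = ∫ z, g z.1 ∂π n := by
      rw [← (hcpl n).2.1, integral_map measurable_fst.aemeasurable
        hg.measurable.aestronglyMeasurable]
    have h2 : ∫ θ, g θ ∂posterior Φ μ = ∫ z, g z.2 ∂π n := by
      rw [← (hcpl n).2.2, integral_map measurable_snd.aemeasurable
        hg.measurable.aestronglyMeasurable]
    simp only [h1, h2, one_mul]
    exact edist_integral_le_lintegral_edist (hgi _ measurable_fst) (hgi _ measurable_snd)
  have hZ : Tendsto (fun n => evidence Φ (μs n)) atTop (𝓝 (evidence Φ μ)) := by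
    have hne : ∫ θ, g θ ∂posterior Φ μ ≠ 0 := fun h0 =>
      (evidence_pos Φ μ hΦ).ne' (by
        rw [evidence_eq_inv_integral_exp_posterior Φ μ hΦ, show ∫ θ, Real.exp (Φ θ)
          ∂posterior Φ μ = 0 from h0, inv_zero])
    have h := hint.inv₀ hne
    rw [evidence_eq_inv_integral_exp_posterior Φ μ hΦ]
    exact h.congr fun n => (evidence_eq_inv_integral_exp_posterior Φ (μs n) hΦ).symm
  refine ⟨hZ, ?_⟩
  have h := tendsto_wasserstein_withDensity hp hcpl hπ
    (lintegral_posterior_ne_top Φ μ hΦ (by fun_prop) hx₀.ne) hg hg0 hgM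
    (fun n => (evidence_pos Φ (μs n) hΦ).le) (fun n => evidence_le_one Φ (μs n) hΦ) hZ
    (fun n => lintegral_exp_mul_evidence_posterior Φ (μs n) hΦ)
    (lintegral_exp_mul_evidence_posterior Φ μ hΦ)
  simpa only [g, posterior_withDensity Φ _ hΦ] using h
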